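/- An $n$-simplex $S$ is the convex hull of $n+1$ affinely independent points $v_0,\dots,v_n\in\mathbb{R}^n$ (its vertices); a $k$-facet of $S$ is the $k$-simplex spanned by $k+1$ of its vertices, called triangular for $k=2$ and tetrahedral for $k=3$. A vertex Gramian of $S$ associated with the vertex $v_\ell$ is a matrix $P_\ell^\top P_\ell$, where $P_\ell$ is an $n\times n$ matrix whose columns are, in some order, the vectors $v_k-v_\ell$ with $k\neq\ell$. A triangle is nonobtuse if none of its angles exceeds $\pi/2$. A sub-orthocentric point of a nonobtuse triangle is a convex combination of one of its vertices and its orthocenter. A tetrahedron is sub-orthocentric if all its triangular facets are nonobtuse and each of its altitudes meets the opposite facet in a sub-orthocentric point of that facet; that is, each vertex projects orthogonally onto a sub-orthocentric point of its opposite facet. A real symmetric positive definite matrix $A=(a_{ij})\in\mathbb{R}^{n\times n}$ is called (symmetric) ultrametric if $a_{ij}\ge 0$ and $a_{ij}\le a_{ii}$ for all $i,j$, and no $3\times 3$ principal submatrix of $A$ has a unique minimal entry above its diagonal: for all $i<j<k$, the minimum of $a_{ij},a_{ik},a_{jk}$ is attained at least twice. A set $\mathcal{C}$ of real symmetric positive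 definite $n\times n$ matrices is a simplicial matrix class if, whenever $A\in\mathcal{C}$ is a vertex Gramian of an $n$-simplex $S$, all vertex Gramians of $S$ belong to $\mathcal{C}$. **Theorem.** Let $n\ge 3$ and let $S$ be an $n$-simplex. The following are equivalent: (a) $S$ has a vertex $v$ such that all tetrahedral facets of $S$ that contain $v$ are sub-orthocentric; (b) all tetrahedral facets of $S$ are sub-orthocentric; (c) $S$ has an ultrametric vertex Gramian; (d) all vertex Gramians of $S$ are ultrametric. In particular, for every $n\ge 1$, the set of all symmetric positive definite ultrametric $n\times n$ matrices is a simplicial matrix class. -/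

import Mathlib

noncomputable section

namespace SimplicialMatrix

section Geometry

variable {V P : Type*} [NormedAddCommGroup V] [InnerProductSpace ℝ V] [MetricSpace P]
  [NormedAddTorsor V P]

/-- A triangle is nonobtuse if none of its three angles exceeds `π / 2`. -/
def Nonobtuse (t : Affine.Triangle ℝ P) : Prop :=
  ∀ i j k : Fin 3, i ≠ j → j ≠ k → i ≠ k →
    EuclideanGeometry.angle (t.points i) (t.points j) (t.points k) ≤ Real.pi / 2

/-- The sub-orthocentric points of a (nonobtuse) triangle: the convex combinations of a vertex and
the orthocenter. -/
def subOrthocentricSet (t : Affine.Triangle ℝ P) : Set P :=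
  {x | ∃ i : Fin 3, Wbtw ℝ (t.points i) x t.orthocenter}

/-- A tetrahedron with nonobtuse triangular facets is sub-orthocentric if each of its altitudes
meets the opposite facet in a sub-orthocentric point of that facet. -/
def SubOrthocentric (T : Affine.Simplex ℝ P 3) : Prop :=
  (∀ i : Fin 4, Nonobtuse (T.faceOpposite i)) ∧
    ∀ i : Fin 4, T.altitudeFoot i ∈ subOrthocentricSet (T.faceOpposite i)

end Geometry

/-- An `n`-simplex in Euclidean `n`-space, given by its `n + 1` affinely independent vertices. -/
abbrev NSimplex (n : ℕ) : Type := Affine.Simplex ℝ (EuclideanSpace ℝ (Fin n)) n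

/-- `G` is a vertex Gramian of `S` associated with the vertex `ℓ`: it equals `Pᵀ * P` for a matrix
`P` whose columns are, in some order, the vectors from the vertex `ℓ` to the other vertices. -/
def IsVertexGramianAt {n : ℕ} (S : NSimplex n) (ℓ : Fin (n + 1))
    (G : Matrix (Fin n) (Fin n) ℝ) : Prop :=
  ∃ (σ : Fin n ≃ {k : Fin (n + 1) // k ≠ ℓ}) (P : Matrix (Fin n) (Fin n) ℝ),
    (∀ i j, P i j = (S.points (σ j) - S.points ℓ) i) ∧ G = P.transpose * P

/-- `G` is a vertex Gramian of `S`, associated with some vertex. -/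
def IsVertexGramian {n : ℕ} (S : NSimplex n) (G : Matrix (Fin n) (Fin n) ℝ) : Prop :=
  ∃ ℓ : Fin (n + 1), IsVertexGramianAt S ℓ G

/-- Symmetric ultrametric matrices: symmetric positive definite, entrywise nonnegative, every
diagonal entry is maximal in its row, and no `3 × 3` principal submatrix has a unique minimal entry
above its diagonal. -/
structure IsSymmUltrametric {n : ℕ} (A : Matrix (Fin n) (Fin n) ℝ) : Prop where
  posDef : A.PosDef
  nonneg : ∀ i j, 0 ≤ A i j
  le_diag : ∀ i j, A i j ≤ A i i
  no_unique_min : ∀ i j k, i < j → j < k →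
    ¬ (A i j < A i k ∧ A i j < A j k) ∧
    ¬ (A i k < A i j ∧ A i k < A j k) ∧
    ¬ (A j k < A i j ∧ A j k < A i k)

/-- The class of all vertex Gramians of the simplices underlying `A`, that is, of the simplices that
have `A` as a vertex Gramian. -/
def gramianClass {n : ℕ} (A : Matrix (Fin n) (Fin n) ℝ) : Set (Matrix (Fin n) (Fin n) ℝ) :=
  {B | ∃ S : NSimplex n, IsVertexGramian S A ∧ IsVertexGramian S B}

/-- A simplicial matrix class: a set of symmetric positive definite matrices that contains, with
each matrix, all vertex Gramians of its underlying simplex. -/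
def IsSimplicialMatrixClass {n : ℕ} (C : Set (Matrix (Fin n) (Fin n) ℝ)) : Prop :=
  (∀ A ∈ C, A.PosDef) ∧ ∀ A ∈ C, gramianClass A ⊆ C

end SimplicialMatrix

end

/-! Everything is expressed through the squared distances `D` between vertices. By polarization, a
Gramian entry at `ℓ` is half the Gromov product `D ℓ i + D ℓ j - D i j`, so ultrametricity of that
Gramian is the four-point condition on quadruples containing `ℓ`
(`IsVertexGramianAt.isSymmUltrametric_iff`). For one tetrahedron, the condition says that the two
largest of the three sums over opposite edges agree; this is sub-orthocentricity
(`subOrthocentric_iff`). As for 0-hyperbolic spaces, the base point is irrelevant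
(`FourPointAt.change_base`), which passes from one vertex to all. -/

namespace SimplicialMatrix

open scoped RealInnerProductSpace

/-! ### The four-point condition -/

section FourPoint

variable {ι : Type*}

/-- Gromov's four-point condition for `D`, restricted to the quadruples that contain `ℓ`. -/
def FourPointAt (D : ι → ι → ℝ) (ℓ : ι) : Prop :=
  ∀ i j k, D ℓ i + D j k ≤ max (D ℓ j + D i k) (D ℓ k + D i j)

/-- The four-point condition at one base point implies it at every other one. -/
theorem FourPointAt.change_base {D : ι → ι → ℝ} (hsymm : ∀ i j, D i j = D j i) {ℓ : ι}
    (h : FourPointAt D ℓ) (m : ι) : FourPointAt D m := by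
  intro i j k
  -- `-E` is twice the Gromov product based at `ℓ`. Adding `f a + f b` to `D a b` preserves
  -- four-point inequalities, and at `ℓ` they become the ultrametric inequality for `E`.
  obtain ⟨E, hE⟩ : ∃ E : ι → ι → ℝ, ∀ a b, D a b = E a b + D ℓ a + D ℓ b :=
    ⟨fun a b ↦ D a b - D ℓ a - D ℓ b, fun a b ↦ by ring⟩
  have hs : ∀ a b, E a b = E b a := fun a b ↦ by linarith [hE a b, hE b a, hsymm a b]
  have ultra : ∀ a b c, E a b ≤ E a c ∨ E a b ≤ E b c := by
    intro a b c
    have := h c a b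
    rw [le_max_iff, hsymm c a, hsymm c b, hE a b, hE a c, hE b c] at this
    rcases this with h | h
    · right; linarith
    · left; linarith
  rw [le_max_iff, hE m i, hE j k, hE m j, hE i k, hE m k, hE i j]
  -- In the quadrilateral `m j i k`, each diagonal is bounded by a side in both triangles it
  -- borders.
  have key : E m i + E j k ≤ E m j + E i k ∨ E m i + E j k ≤ E m k + E i j := by
    have h1 := ultra m i j
    have h2 := ultra m i k
    have h3 := ultra j k m
    have h4 := ultra j k i
    rw [hs j m, hs k m] at h3
    rw [hs j i, hs k i] at h4
    clear ultra hs hE hsymm h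
    grind
  rcases key with h | h
  · left; linarith
  · right; linarith

/-- Under the triangle inequality, it suffices to check the four-point condition on quadruples of
pairwise distinct points. -/
theorem fourPointAt_of_distinct {D : ι → ι → ℝ} (hsymm : ∀ i j, D i j = D j i)
    (hself : ∀ i, D i i = 0) (htri : ∀ i j k, D i k ≤ D i j + D j k) {ℓ : ι}
    (h : ∀ i j k, ℓ ≠ i → ℓ ≠ j → ℓ ≠ k → i ≠ j → j ≠ k → i ≠ k →
      D ℓ i + D j k ≤ max (D ℓ j + D i k) (D ℓ k + D i j)) : FourPointAt D ℓ := by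
  have hnn : ∀ i j, 0 ≤ D i j := fun i j ↦ by
    linarith [htri i j i, hsymm i j, hself i]
  intro i j k
  have t1 := htri j ℓ k
  have t2 := htri ℓ j i
  have t3 := htri ℓ k i
  have n1 := hnn j k
  have n2 := hnn ℓ i
  rw [hsymm j i] at t2
  rw [hsymm k i] at t3
  rw [hsymm j ℓ] at t1
  clear hnn htri
  rw [le_max_iff]
  by_cases h1 : ℓ = i
  · subst h1; left; linarith [hself ℓ]
  by_cases h2 : ℓ = j
  · subst h2; right; linarith [hself ℓ, hsymm ℓ i]
  by_cases h3 : ℓ = k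
  · subst h3; left; linarith [hself ℓ, hsymm ℓ i, hsymm ℓ j]
  by_cases h4 : i = j
  · subst h4; left; linarith [hself i]
  by_cases h5 : j = k
  · subst h5; left; linarith [hself j]
  by_cases h6 : i = k
  · subst h6; right; linarith [hsymm i j]
  rw [← le_max_iff]
  exact h i j k h1 h2 h3 h4 h5 h6

end FourPoint

/-! ### Sub-orthocentric tetrahedra -/

section Geometry

theorem dist_sq_eq_norm_sub_sq {V P : Type*} [NormedAddCommGroup V] [MetricSpace P]
    [NormedAddTorsor V P] (x y o : P) : dist x y ^ 2 = ‖(x -ᵥ o) - (y -ᵥ o)‖ ^ 2 := by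
  rw [vsub_sub_vsub_cancel_right, dist_eq_norm_vsub V]

variable {V P : Type*} [NormedAddCommGroup V] [InnerProductSpace ℝ V] [MetricSpace P]
  [NormedAddTorsor V P]

/-- The squared distances between the points of a family. -/
def sqDist {ι : Type*} (p : ι → P) (i j : ι) : ℝ := dist (p i) (p j) ^ 2

theorem sqDist_comm {ι : Type*} (p : ι → P) (i j : ι) : sqDist p i j = sqDist p j i := by
  rw [sqDist, dist_comm, sqDist]

theorem sqDist_self {ι : Type*} (p : ι → P) (i : ι) : sqDist p i i = 0 := by
  simp [sqDist]

/-- The law of cosines. -/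
theorem angle_le_pi_div_two_iff (x y z : P) :
    EuclideanGeometry.angle x y z ≤ Real.pi / 2 ↔
      dist x z ^ 2 ≤ dist x y ^ 2 + dist y z ^ 2 := by
  have hinner : EuclideanGeometry.angle x y z ≤ Real.pi / 2 ↔ 0 ≤ ⟪x -ᵥ y, z -ᵥ y⟫ := by
    rw [EuclideanGeometry.angle, InnerProductGeometry.angle, Real.arccos_le_pi_div_two]
    refine ⟨fun h ↦ ?_, fun h ↦ by positivity⟩
    rw [← InnerProductGeometry.cos_angle_mul_norm_mul_norm, InnerProductGeometry.cos_angle]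
    positivity
  rw [hinner, dist_sq_eq_norm_sub_sq x z y, norm_sub_sq_real, ← dist_eq_norm_vsub V, ← dist_eq_norm_vsub V,
    dist_comm z y]
  constructor <;> intro h <;> linarith

theorem inner_orthocenter_vsub (t : Affine.Triangle ℝ P) {i j k : Fin 3} (hij : i ≠ j)
    (hjk : j ≠ k) (hik : i ≠ k) :
    ⟪t.orthocenter -ᵥ t.points i, t.points j -ᵥ t.points k⟫ = 0 := by
  -- The orthocenter is the Monge point of the triangle; the face centroid here is the vertex `i`.
  have h := t.inner_mongePoint_vsub_face_centroid_vsub (i₁ := j) (i₂ := k)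
  have hc : ({j, k}ᶜ : Finset (Fin 3)) = {i} := by
    clear h
    decide +revert
  rw [hc, Finset.centroid_singleton] at h
  exact h

/-- A vector in the direction of a triangle that is orthogonal to two sides vanishes. -/
theorem eq_zero_of_inner_sides_eq_zero (t : Affine.Triangle ℝ P) {i j k : Fin 3} (hij : i ≠ j)
    (hjk : j ≠ k) (hik : i ≠ k) {w : V} (hw : w ∈ (affineSpan ℝ (Set.range t.points)).direction)
    (hj : ⟪w, t.points j -ᵥ t.points i⟫ = 0) (hk : ⟪w, t.points k -ᵥ t.points i⟫ = 0) :
    w = 0 := by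
  have hle : (affineSpan ℝ (Set.range t.points)).direction ≤ (ℝ ∙ w)ᗮ := by
    rw [direction_affineSpan, vectorSpan_range_eq_span_range_vsub_right ℝ t.points i,
      Submodule.span_le]
    rintro _ ⟨m, rfl⟩
    have hm : m = i ∨ m = j ∨ m = k := by
      clear hj hk
      decide +revert
    rw [SetLike.mem_coe, Submodule.mem_orthogonal_singleton_iff_inner_right]
    rcases hm with rfl | rfl | rfl
    · simp
    · exact hj
    · exact hk
  exact inner_self_eq_zero.1 (Submodule.mem_orthogonal_singleton_iff_inner_right.1 (hle hw))

variable {t : Affine.Triangle ℝ P} {p q : P} {i j k : Fin 3}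

/-- Seen from vertex `i`, with sides `u`, `v` and `r` pointing to `p`, the claims read `⟪r, u⟫ = ⟪r,
v⟫ ≤ ⟪u, v⟫`. The orthocenter `h` satisfies `⟪h, u⟫ = ⟪h, v⟫ = ⟪u, v⟫`, and `r` projects to `s • h`
with `s ≤ 1`. -/
theorem sqDist_of_wbtw_orthocenter (hpq : ∀ a b, ⟪p -ᵥ q, t.points a -ᵥ t.points b⟫ = 0)
    (hij : i ≠ j) (hjk : j ≠ k) (hik : i ≠ k) (hn : Nonobtuse t)
    (hb : Wbtw ℝ (t.points i) q t.orthocenter) :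
    dist p (t.points j) ^ 2 + dist (t.points i) (t.points k) ^ 2 =
        dist p (t.points k) ^ 2 + dist (t.points i) (t.points j) ^ 2 ∧
      dist p (t.points i) ^ 2 + dist (t.points j) (t.points k) ^ 2 ≤
        dist p (t.points j) ^ 2 + dist (t.points i) (t.points k) ^ 2 := by
  have hc := (angle_le_pi_div_two_iff _ _ _).1 (hn j i k hij.symm hik hjk)
  obtain ⟨s, ⟨-, hs1⟩, rfl⟩ := hb
  have h1 := inner_orthocenter_vsub t hik.symm hij hjk.symm
  have h2 := inner_orthocenter_vsub t hij.symm hik hjk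
  have h3 := hpq j i
  have h4 := hpq k i
  simp only [dist_sq_eq_norm_sub_sq _ _ (t.points i)] at hc ⊢
  rw [← vsub_sub_vsub_cancel_right _ _ (t.points i), AffineMap.lineMap_vsub_left] at h3 h4
  rw [← vsub_sub_vsub_cancel_right _ (t.points k) (t.points i), ← neg_vsub_eq_vsub_rev (t.points j),
    inner_neg_right, neg_eq_zero] at h1
  rw [← vsub_sub_vsub_cancel_right _ (t.points j) (t.points i), ← neg_vsub_eq_vsub_rev (t.points k),
    inner_neg_right, neg_eq_zero] at h2
  rw [vsub_self] at hc ⊢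
  generalize t.points j -ᵥ t.points i = u at *
  generalize t.points k -ᵥ t.points i = v at *
  generalize t.orthocenter -ᵥ t.points i = h at *
  generalize p -ᵥ t.points i = r at *
  simp only [inner_sub_left, real_inner_smul_left, sub_zero, zero_sub, norm_neg, norm_sub_sq_real,
    real_inner_comm u v] at *
  constructor <;> nlinarith

/-- The hypotheses say `0 ≤ ⟪r, u⟫ = ⟪r, v⟫ ≤ ⟪u, v⟫`, so the position of `q` on the altitude is
`⟪r, u⟫ / ⟪u, v⟫`. -/
theorem wbtw_orthocenter_of_sqDist (hq : q ∈ affineSpan ℝ (Set.range t.points))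
    (hpq : ∀ a b, ⟪p -ᵥ q, t.points a -ᵥ t.points b⟫ = 0)
    (hij : i ≠ j) (hjk : j ≠ k) (hik : i ≠ k)
    (hp : dist p (t.points j) ^ 2 ≤ dist p (t.points i) ^ 2 + dist (t.points i) (t.points j) ^ 2)
    (heq : dist p (t.points j) ^ 2 + dist (t.points i) (t.points k) ^ 2 =
        dist p (t.points k) ^ 2 + dist (t.points i) (t.points j) ^ 2)
    (hle : dist p (t.points i) ^ 2 + dist (t.points j) (t.points k) ^ 2 ≤
        dist p (t.points j) ^ 2 + dist (t.points i) (t.points k) ^ 2) :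
    Wbtw ℝ (t.points i) q t.orthocenter := by
  have hi := mem_affineSpan ℝ (Set.mem_range_self (f := t.points) i)
  have hqd := AffineSubspace.vsub_mem_direction hq hi
  have hhd := AffineSubspace.vsub_mem_direction t.orthocenter_mem_affineSpan hi
  have hz := fun w ↦ eq_zero_of_inner_sides_eq_zero t hij hjk hik (w := w)
  have h1 := inner_orthocenter_vsub t hik.symm hij hjk.symm
  have h2 := inner_orthocenter_vsub t hij.symm hik hjk
  have h3 := hpq j i
  have h4 := hpq k i
  suffices hs : ∃ s ∈ Set.Icc (0 : ℝ) 1,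
      q -ᵥ t.points i = s • (t.orthocenter -ᵥ t.points i) by
    obtain ⟨s, hs, h⟩ := hs
    refine ⟨s, hs, ?_⟩
    rw [AffineMap.lineMap_apply, ← h, vsub_vadd]
  simp only [dist_sq_eq_norm_sub_sq _ _ (t.points i)] at hp heq hle
  rw [← vsub_sub_vsub_cancel_right p q (t.points i)] at h3 h4
  rw [← vsub_sub_vsub_cancel_right _ (t.points k) (t.points i), ← neg_vsub_eq_vsub_rev (t.points j),
    inner_neg_right, neg_eq_zero] at h1
  rw [← vsub_sub_vsub_cancel_right _ (t.points j) (t.points i), ← neg_vsub_eq_vsub_rev (t.points k),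
    inner_neg_right, neg_eq_zero] at h2
  rw [vsub_self] at hp heq hle
  clear hpq
  generalize t.points j -ᵥ t.points i = u at *
  generalize t.points k -ᵥ t.points i = v at *
  generalize t.orthocenter -ᵥ t.points i = h at *
  generalize p -ᵥ t.points i = r at *
  generalize q -ᵥ t.points i = w at *
  simp only [inner_sub_left, sub_zero, zero_sub, norm_neg, norm_sub_sq_real,
    real_inner_comm u v] at h1 h2 h3 h4 hp heq hle
  have hru : 0 ≤ ⟪r, u⟫ := by linarith
  have huv : ⟪r, u⟫ ≤ ⟪u, v⟫ := by linarith
  -- At a right angle the quotient is `0` by convention, which is correct since then `⟪r, u⟫ = 0`.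
  have hmul : ⟪r, u⟫ / ⟪u, v⟫ * ⟪u, v⟫ = ⟪r, u⟫ := by
    rcases eq_or_ne ⟪u, v⟫ 0 with h0 | h0
    · rw [h0] at huv ⊢
      rw [mul_zero]
      linarith
    · exact div_mul_cancel₀ _ h0
  refine ⟨⟪r, u⟫ / ⟪u, v⟫, ⟨div_nonneg hru (hru.trans huv), div_le_one_of_le₀ huv (hru.trans huv)⟩,
    sub_eq_zero.1 (hz _ (Submodule.sub_mem _ hqd (Submodule.smul_mem _ _ hhd)) ?_ ?_)⟩
  · rw [inner_sub_left, real_inner_smul_left, show ⟪h, u⟫ = ⟪u, v⟫ by linarith, hmul]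
    linarith
  · rw [inner_sub_left, real_inner_smul_left, show ⟪h, v⟫ = ⟪u, v⟫ by linarith, hmul]
    linarith

theorem inner_vsub_altitudeFoot_eq_zero (T : Affine.Simplex ℝ P 3) (m : Fin 4) (a b : Fin 3) :
    ⟪T.points m -ᵥ T.altitudeFoot m,
      (T.faceOpposite m).points a -ᵥ (T.faceOpposite m).points b⟫ = 0 := by
  rw [real_inner_comm]
  exact Submodule.inner_right_of_mem_orthogonal
    (AffineSubspace.vsub_mem_direction (mem_affineSpan ℝ (Set.mem_range_self a))
      (mem_affineSpan ℝ (Set.mem_range_self b)))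
    (EuclideanGeometry.vsub_orthogonalProjection_mem_direction_orthogonal _ _)

/-- All facets of a tetrahedron are nonobtuse if and only if the squared distances between the
vertices satisfy the triangle inequality. -/
theorem forall_nonobtuse_iff (T : Affine.Simplex ℝ P 3) :
    (∀ m, Nonobtuse (T.faceOpposite m)) ↔
      ∀ i j k, sqDist T.points i k ≤ sqDist T.points i j + sqDist T.points j k := by
  simp only [Nonobtuse, angle_le_pi_div_two_iff,
    Affine.Simplex.faceOpposite_point_eq_point_succAbove, Fin.cast_eq_self]
  constructor
  · intro h i j k
    by_cases hij : i = j
    · rw [hij, sqDist_self, zero_add]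
    by_cases hjk : j = k
    · rw [hjk, sqDist_self, add_zero]
    by_cases hik : i = k
    · rw [hik, sqDist_self]
      unfold sqDist
      positivity
    obtain ⟨m, hi, hj, hk⟩ : ∃ m : Fin 4, i ≠ m ∧ j ≠ m ∧ k ≠ m := by
      clear h
      decide +revert
    obtain ⟨i, rfl⟩ := Fin.exists_succAbove_eq hi
    obtain ⟨j, rfl⟩ := Fin.exists_succAbove_eq hj
    obtain ⟨k, rfl⟩ := Fin.exists_succAbove_eq hk
    exact h m i j k (by grind) (by grind) (by grind)
  · intro h m i j k _ _ _
    exact h _ _ _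

/-- A tetrahedron is sub-orthocentric if and only if the squared distances between its vertices
satisfy the four-point condition. -/
theorem subOrthocentric_iff (T : Affine.Simplex ℝ P 3) :
    SubOrthocentric T ↔ ∀ ℓ, FourPointAt (sqDist T.points) ℓ := by
  constructor
  · rintro ⟨hn, hf⟩ ℓ
    refine fourPointAt_of_distinct (sqDist_comm _) (sqDist_self _)
      ((forall_nonobtuse_iff T).1 hn) ?_
    intro a b c hla hlb hlc hab hbc hac
    obtain ⟨a, rfl⟩ := Fin.exists_succAbove_eq hla.symm
    obtain ⟨b, rfl⟩ := Fin.exists_succAbove_eq hlb.symm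
    obtain ⟨c, rfl⟩ := Fin.exists_succAbove_eq hlc.symm
    obtain ⟨i, hi⟩ := hf ℓ
    obtain ⟨j, k, hij, hjk, hik⟩ : ∃ j k, i ≠ j ∧ j ≠ k ∧ i ≠ k := by
      clear * -
      decide +revert
    have hd := sqDist_of_wbtw_orthocenter (inner_vsub_altitudeFoot_eq_zero T ℓ) hij hjk hik
      (hn ℓ) hi
    simp only [Affine.Simplex.faceOpposite_point_eq_point_succAbove, Fin.cast_eq_self] at hd
    change sqDist T.points _ _ + sqDist T.points _ _ = sqDist T.points _ _ + sqDist T.points _ _ ∧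
      sqDist T.points _ _ + sqDist T.points _ _ ≤ sqDist T.points _ _ + sqDist T.points _ _ at hd
    have ha : a = i ∨ a = j ∨ a = k := by clear * - hij hjk hik; decide +revert
    have hb : b = i ∨ b = j ∨ b = k := by clear * - hij hjk hik; decide +revert
    have hc : c = i ∨ c = j ∨ c = k := by clear * - hij hjk hik; decide +revert
    have hs := sqDist_comm T.points
    rw [le_max_iff]
    clear hf hn hi
    rcases ha with rfl | rfl | rfl <;> rcases hb with rfl | rfl | rfl <;>
      rcases hc with rfl | rfl | rfl <;> grind
  · intro h
    have htri : ∀ i j k, sqDist T.points i k ≤ sqDist T.points i j + sqDist T.points j k := by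
      intro i j k
      -- A quadruple with a repeated point gives the triangle inequality.
      have h1 := h j j i k
      rw [sqDist_self, zero_add, sqDist_comm _ j i, add_comm (sqDist _ j k), max_self] at h1
      exact h1
    refine ⟨(forall_nonobtuse_iff T).2 htri, fun ℓ ↦ ?_⟩
    -- The vertex `i` is chosen so that the edge from `ℓ` to it belongs to a smallest opposite-edge
    -- sum.
    obtain ⟨i, j, k, hij, hjk, hik, heq, hle⟩ : ∃ i j k : Fin 3, i ≠ j ∧ j ≠ k ∧ i ≠ k ∧
        sqDist T.points ℓ (ℓ.succAbove j) + sqDist T.points (ℓ.succAbove i) (ℓ.succAbove k) =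
          sqDist T.points ℓ (ℓ.succAbove k) + sqDist T.points (ℓ.succAbove i) (ℓ.succAbove j) ∧
        sqDist T.points ℓ (ℓ.succAbove i) + sqDist T.points (ℓ.succAbove j) (ℓ.succAbove k) ≤
          sqDist T.points ℓ (ℓ.succAbove j) + sqDist T.points (ℓ.succAbove i) (ℓ.succAbove k) := by
      have h0 := h ℓ (ℓ.succAbove 0) (ℓ.succAbove 1) (ℓ.succAbove 2)
      have h1 := h ℓ (ℓ.succAbove 1) (ℓ.succAbove 2) (ℓ.succAbove 0)
      have h2 := h ℓ (ℓ.succAbove 2) (ℓ.succAbove 0) (ℓ.succAbove 1)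
      have e1 := sqDist_comm T.points (ℓ.succAbove 1) (ℓ.succAbove 0)
      have e2 := sqDist_comm T.points (ℓ.succAbove 2) (ℓ.succAbove 0)
      have e3 := sqDist_comm T.points (ℓ.succAbove 2) (ℓ.succAbove 1)
      rw [e1, e2] at h1
      rw [e2, e3] at h2
      rw [le_max_iff] at h0 h1 h2
      by_cases hx : sqDist T.points ℓ (ℓ.succAbove 1) +
          sqDist T.points (ℓ.succAbove 0) (ℓ.succAbove 2) = sqDist T.points ℓ (ℓ.succAbove 2) +
            sqDist T.points (ℓ.succAbove 0) (ℓ.succAbove 1)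
      · refine ⟨0, 1, 2, by decide, by decide, by decide, hx, ?_⟩
        grind
      by_cases hy : sqDist T.points ℓ (ℓ.succAbove 0) +
          sqDist T.points (ℓ.succAbove 1) (ℓ.succAbove 2) = sqDist T.points ℓ (ℓ.succAbove 2) +
            sqDist T.points (ℓ.succAbove 0) (ℓ.succAbove 1)
      · refine ⟨1, 0, 2, by decide, by decide, by decide, ?_, ?_⟩ <;> grind
      · refine ⟨2, 0, 1, by decide, by decide, by decide, ?_, ?_⟩ <;> grind
    refine ⟨i, wbtw_orthocenter_of_sqDist (T.altitudeFoot_mem_affineSpan_faceOpposite ℓ)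
      (inner_vsub_altitudeFoot_eq_zero T ℓ) hij hjk hik ?_ ?_ ?_⟩
    · simpa only [Affine.Simplex.faceOpposite_point_eq_point_succAbove, Fin.cast_eq_self,
        sqDist] using htri ℓ (ℓ.succAbove i) (ℓ.succAbove j)
    · simpa only [Affine.Simplex.faceOpposite_point_eq_point_succAbove, Fin.cast_eq_self,
        sqDist] using heq
    · simpa only [Affine.Simplex.faceOpposite_point_eq_point_succAbove, Fin.cast_eq_self,
        sqDist] using hle

end Geometry

/-! ### Vertex Gramians and Gromov products -/

section Gramian

variable {n : ℕ} {S : NSimplex n} {ℓ : Fin (n + 1)}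

theorem exists_isVertexGramianAt (S : NSimplex n) (ℓ : Fin (n + 1)) :
    ∃ G, IsVertexGramianAt S ℓ G :=
  ⟨_, finSuccAboveEquiv ℓ, Matrix.of fun i j ↦ (S.points (finSuccAboveEquiv ℓ j) - S.points ℓ) i,
    fun _ _ ↦ rfl, rfl⟩

theorem IsVertexGramianAt.posDef {G : Matrix (Fin n) (Fin n) ℝ} (h : IsVertexGramianAt S ℓ G) :
    G.PosDef := by
  obtain ⟨σ, M, hM, rfl⟩ := h
  rw [← Matrix.conjTranspose_eq_transpose_of_trivial]
  refine Matrix.PosDef.conjTranspose_mul_self M ?_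
  rw [Matrix.mulVec_injective_iff]
  have hli := ((affineIndependent_iff_linearIndependent_vsub ℝ S.points ℓ).1 S.independent).comp
    σ σ.injective
  have hli' := hli.map' (WithLp.linearEquiv 2 ℝ (Fin n → ℝ)).toLinearMap (LinearEquiv.ker _)
  have hcol : M.col = WithLp.linearEquiv 2 ℝ (Fin n → ℝ) ∘
      (fun k : {k : Fin (n + 1) // k ≠ ℓ} ↦ S.points k -ᵥ S.points ℓ) ∘ σ := by
    ext j i
    simp [Matrix.col, hM]
  rw [hcol]
  exact hli'

theorem gramianAt_apply {σ : Fin n ≃ {k : Fin (n + 1) // k ≠ ℓ}} {M : Matrix (Fin n) (Fin n) ℝ}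
    (hM : ∀ i j, M i j = (S.points (σ j) - S.points ℓ) i) (i j : Fin n) :
    2 * (M.transpose * M) i j = sqDist S.points ℓ (σ i) + sqDist S.points ℓ (σ j) -
      sqDist S.points (σ i) (σ j) := by
  have h : (M.transpose * M) i j = ⟪S.points (σ i) - S.points ℓ, S.points (σ j) - S.points ℓ⟫ := by
    rw [Matrix.mul_apply, PiLp.inner_apply]
    refine Finset.sum_congr rfl fun k _ ↦ ?_
    rw [Matrix.transpose_apply, hM, hM]
    simp [mul_comm]
  have hd := dist_sq_eq_norm_sub_sq (S.points (σ i)) (S.points (σ j)) (S.points ℓ)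
  rw [norm_sub_sq_real] at hd
  simp only [vsub_eq_sub] at hd
  rw [h, sqDist, sqDist, sqDist, hd, dist_comm, dist_comm (S.points ℓ), dist_eq_norm, dist_eq_norm]
  ring

/-- A vertex Gramian is ultrametric if and only if the squared distances between the vertices
satisfy the four-point condition at the base vertex. -/
theorem IsVertexGramianAt.isSymmUltrametric_iff {G : Matrix (Fin n) (Fin n) ℝ}
    (h : IsVertexGramianAt S ℓ G) :
    IsSymmUltrametric G ↔ FourPointAt (sqDist S.points) ℓ := by
  have hpos := h.posDef
  obtain ⟨σ, M, hM, rfl⟩ := h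
  have hG := gramianAt_apply hM
  generalize M.transpose * M = G at *
  have hs := sqDist_comm S.points
  have h0 := sqDist_self S.points
  generalize sqDist S.points = D at *
  have hsymm : ∀ i j, G i j = G j i := fun i j ↦ by linarith [hG i j, hG j i, hs (σ i) (σ j)]
  constructor
  · intro hu
    -- Distinct indices are sorted to apply `no_unique_min`; coinciding ones reduce to `le_diag`.
    have hmin : ∀ i j k, G i k ≤ G i j ∨ G j k ≤ G i j := by
      intro i j k
      have a1 := hu.no_unique_min i j k
      have a2 := hu.no_unique_min i k j
      have a3 := hu.no_unique_min j i k
      have a4 := hu.no_unique_min j k i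
      have a5 := hu.no_unique_min k i j
      have a6 := hu.no_unique_min k j i
      have b1 := hu.le_diag i k
      have b2 := hu.le_diag j k
      have s1 := hsymm i j
      have s2 := hsymm j k
      have s3 := hsymm i k
      rcases lt_trichotomy i j with hij | hij | hij <;>
        rcases lt_trichotomy j k with hjk | hjk | hjk <;>
        rcases lt_trichotomy i k with hik | hik | hik <;> grind
    intro a b c
    have hcases : ∀ m, m = ℓ ∨ ∃ x, m = σ x := fun m ↦ by
      by_cases hm : m = ℓ
      · exact .inl hm
      · exact .inr ⟨σ.symm ⟨m, hm⟩, by simp⟩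
    -- This is `hmin` extended to the base vertex; nonnegativity enters when `c = ℓ`.
    have key : ∀ a b c, D ℓ c - D a c ≤ D ℓ b - D a b ∨ D ℓ c - D b c ≤ D ℓ a - D a b := by
      intro a b c
      rcases hcases a with rfl | ⟨i, rfl⟩
      · left; linarith
      rcases hcases b with rfl | ⟨j, rfl⟩
      · right; linarith [hs b (σ i)]
      rcases hcases c with rfl | ⟨k, rfl⟩
      · left; linarith [hs c (σ i), h0 c, hG i j, hu.nonneg i j]
      rcases hmin i j k with h | h
      · left; linarith [hG i j, hG i k]
      · right; linarith [hG i j, hG j k]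
    rw [le_max_iff]
    rcases key b c a with h | h
    · right; linarith [hs b a]
    · left; linarith [hs c a]
  · intro hf
    refine ⟨hpos, fun i j ↦ ?_, fun i j ↦ ?_, ?_⟩
    · have := hf ℓ (σ i) (σ j)
      rw [h0, zero_add, add_comm (D ℓ (σ j)), max_self] at this
      linarith [hG i j]
    · have := hf (σ j) (σ i) (σ i)
      rw [h0, add_zero, max_self] at this
      linarith [hG i j, hG i i, h0 (σ i), hs (σ i) (σ j)]
    · intro i j k _ _
      have h1 := hf (σ i) (σ j) (σ k)
      have h2 := hf (σ j) (σ i) (σ k)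
      have h3 := hf (σ k) (σ i) (σ j)
      rw [le_max_iff] at h1 h2 h3
      have g1 := hG i j
      have g2 := hG i k
      have g3 := hG j k
      rw [hs (σ j) (σ i)] at h2
      rw [hs (σ k) (σ i), hs (σ k) (σ j)] at h3
      clear hf hG hs h0 hsymm
      grind

end Gramian

/-! ### Passage between the simplex and its tetrahedral facets -/

/-- If all tetrahedral facets at a vertex are sub-orthocentric, then the squared distances satisfy
the four-point condition at that vertex. -/
theorem fourPointAt_of_subOrthocentric {n : ℕ} (hn : 3 ≤ n) {S : NSimplex n} {v : Fin (n + 1)}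
    (h : ∀ (fs : Finset (Fin (n + 1))) (hc : fs.card = 3 + 1),
      v ∈ fs → SubOrthocentric (S.face hc)) : FourPointAt (sqDist S.points) v := by
  intro i j k
  -- The four points may coincide, so they are padded to four vertices, which `3 ≤ n` permits.
  obtain ⟨fs, hsub, hc⟩ := Finset.exists_superset_card_eq (s := {v, i, j, k}) (n := 3 + 1)
    Finset.card_le_four (by rw [Fintype.card_fin]; lia)
  have hpre : ∀ m ∈ ({v, i, j, k} : Finset (Fin (n + 1))), ∃ x, fs.orderEmbOfFin hc x = m := by
    intro m hm
    have := fs.range_orderEmbOfFin hc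
    exact (this ▸ (hsub hm) : m ∈ Set.range (fs.orderEmbOfFin hc))
  obtain ⟨v', hv⟩ := hpre v (by simp)
  obtain ⟨i', hi⟩ := hpre i (by simp)
  obtain ⟨j', hj⟩ := hpre j (by simp)
  obtain ⟨k', hk⟩ := hpre k (by simp)
  have hT := (subOrthocentric_iff _).1 (h fs hc (hsub (by simp))) v' i' j' k'
  simpa only [sqDist, Affine.Simplex.face_points, hv, hi, hj, hk] using hT

theorem subOrthocentric_face {n : ℕ} {S : NSimplex n}
    (h : ∀ ℓ, FourPointAt (sqDist S.points) ℓ) {fs : Finset (Fin (n + 1))}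
    (hc : fs.card = 3 + 1) : SubOrthocentric (S.face hc) := by
  refine (subOrthocentric_iff _).2 fun ℓ i j k ↦ ?_
  simpa only [sqDist, Affine.Simplex.face_points] using
    h (fs.orderEmbOfFin hc ℓ) (fs.orderEmbOfFin hc i) (fs.orderEmbOfFin hc j)
      (fs.orderEmbOfFin hc k)

theorem IsSymmUltrametric.of_isVertexGramian {n : ℕ} {S : NSimplex n}
    {A B : Matrix (Fin n) (Fin n) ℝ} (hu : IsSymmUltrametric A) (hA : IsVertexGramian S A)
    (hB : IsVertexGramian S B) : IsSymmUltrametric B := by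
  obtain ⟨ℓ, hA⟩ := hA
  obtain ⟨m, hB⟩ := hB
  exact hB.isSymmUltrametric_iff.2
    ((hA.isSymmUltrametric_iff.1 hu).change_base (sqDist_comm _) m)

end SimplicialMatrix

theorem mainTheorem2 :
    (∀ n : ℕ, 3 ≤ n → ∀ S : SimplicialMatrix.NSimplex n,
      List.TFAE [
        ∃ v : Fin (n + 1), ∀ (fs : Finset (Fin (n + 1))) (h : fs.card = 3 + 1),
          v ∈ fs → SimplicialMatrix.SubOrthocentric (S.face h),
        ∀ (fs : Finset (Fin (n + 1))) (h : fs.card = 3 + 1),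
          SimplicialMatrix.SubOrthocentric (S.face h),
        ∃ G : Matrix (Fin n) (Fin n) ℝ,
          SimplicialMatrix.IsVertexGramian S G ∧ SimplicialMatrix.IsSymmUltrametric G,
        ∀ G : Matrix (Fin n) (Fin n) ℝ,
          SimplicialMatrix.IsVertexGramian S G → SimplicialMatrix.IsSymmUltrametric G]) ∧
    (∀ n : ℕ, 1 ≤ n → SimplicialMatrix.IsSimplicialMatrixClass
      {A : Matrix (Fin n) (Fin n) ℝ | SimplicialMatrix.IsSymmUltrametric A}) := by
  refine ⟨fun n hn S ↦ ?_, fun n _ ↦ ⟨fun A hA ↦ hA.posDef, ?_⟩⟩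
  · tfae_have 1 → 3 := by
      rintro ⟨v, hv⟩
      obtain ⟨G, hG⟩ := SimplicialMatrix.exists_isVertexGramianAt S v
      exact ⟨G, ⟨v, hG⟩, hG.isSymmUltrametric_iff.2
        (SimplicialMatrix.fourPointAt_of_subOrthocentric hn hv)⟩
    tfae_have 3 → 4 := fun ⟨_, hG, hu⟩ _ hB ↦ hu.of_isVertexGramian hG hB
    tfae_have 4 → 2 := fun h fs hc ↦ SimplicialMatrix.subOrthocentric_face (fun ℓ ↦ by
      obtain ⟨G, hG⟩ := SimplicialMatrix.exists_isVertexGramianAt S ℓ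
      exact hG.isSymmUltrametric_iff.1 (h G ⟨ℓ, hG⟩)) hc
    tfae_have 2 → 1 := fun h ↦ ⟨0, fun fs hc _ ↦ h fs hc⟩
    tfae_finish
  · rintro A hA B ⟨S, hSA, hSB⟩
    exact hA.of_isVertexGramian hSA hSB
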